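/- Let $F$ be a field; all algebras are associative unital $F$-algebras, and subalgebras contain the unit. Two algebras are Morita equivalent if their categories of left modules are equivalent as $F$-linear categories. An algebra $A$ is called a unital locally matrix algebra if every finite collection of elements of $A$ lies in a subalgebra $B\subseteq A$, $1_A\in B$, with $B\cong M_n(F)$ for some $n\ge 1$. An algebra $A$ is called a tensor product of finite-dimensional matrix algebras if $A\cong\bigotimes_{i\in I}M_{n_i}(F)$ for some (finite or infinite) index set $I$ and integers $n_i\ge 1$, where the tensor product is the direct limit of the tensor products over finite subsets of $I$ along the maps $x\mapsto x\otimes 1$. Let $A$ and $B$ be Morita equivalent $F$-algebras. Then: 1. $A$ is a unital locally matrix algebra if and only if $B$ is. 2. $A$ is a tensor product of finite-dimensional matrix algebras if and only if $B$ is. -/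

import Mathlib

open scoped TensorProduct

universe u v w

/-- A unital `F`-algebra `A` is a locally matrix algebra if every finite collection of its elements
lies in a subalgebra (containing `1`, as every `Subalgebra` does) that is isomorphic to a matrix
algebra `M_n(F)` with `n ≥ 1`. -/
def IsLocallyMatrixAlgebra (F : Type v) [Field F] (A : Type u) [Ring A] [Algebra F A] : Prop :=
  ∀ s : Finset A, ∃ (B : Subalgebra F A) (n : ℕ), 1 ≤ n ∧ (∀ a ∈ s, a ∈ B) ∧
    Nonempty (B ≃ₐ[F] Matrix (Fin n) (Fin n) F)

open Classical in
/-- The tensor product `⨂_{i ∈ ι} A i` of a (possibly infinite) family of nonzero unital algebras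
over a field, in the usual sense for algebras: the union of the finite tensor products
`⨂_{i ∈ J} A i`, `J ⊆ ι` finite, with `x` identified with `x ⊗ 1`. Concretely it is the subalgebra
of Mathlib's `PiTensorProduct` (in which pure tensors may have infinitely many components different
from `1`) generated by the canonical copies `a ↦ ⋯ ⊗ 1 ⊗ a ⊗ 1 ⊗ ⋯` of the factors.
If `ι` is finite this is the whole `PiTensorProduct`; if `ι` is empty it is `F`. -/
noncomputable def algebraTensorProduct (F : Type v) [Field F] {ι : Type u} (A : ι → Type w)
    [∀ i, Ring (A i)] [∀ i, Algebra F (A i)] : Subalgebra F (⨂[F] i, A i) :=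
  ⨆ i, (PiTensorProduct.singleAlgHom (R := F) (A := A) i).range

/-- `A` is isomorphic to a tensor product of matrix algebras `M_{n_i}(F)`, `n_i ≥ 1`, over some
(finite or infinite) index set. -/
def IsTensorProductOfMatrixAlgebras (F : Type v) [Field F] (A : Type u) [Ring A] [Algebra F A] :
    Prop :=
  ∃ (ι : Type u) (n : ι → ℕ), (∀ i, 1 ≤ n i) ∧
    Nonempty (A ≃ₐ[F] algebraTensorProduct F (fun i => Matrix (Fin (n i)) (Fin (n i)) F))

/-- A property of unital `F`-algebras is Morita invariant if any two Morita equivalent `F`-algebras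
(their categories of left modules are equivalent as `F`-linear categories) do satisfy or do not
satisfy it simultaneously. -/
def IsMoritaInvariant (F : Type v) [Field F]
    (P : ∀ (A : Type u) [Ring A] [Algebra F A], Prop) : Prop :=
  ∀ (A B : Type u) [Ring A] [Algebra F A] [Ring B] [Algebra F B],
    IsMoritaEquivalent F A B → (P A ↔ P B)

/-!
Let `A` and `B` be Morita equivalent and let `P` be the `A`-module corresponding to the regular
`B`-module. The `B`-module corresponding to the regular `A`-module has trace ideal `B`, so `1 ∈ B`
is a finite sum of values of homomorphisms from it, and transporting this identity to `A`-modules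
exhibits `P` as a direct summand of some `A^k`. As `B` is the opposite of `End_A(P)`, it is
isomorphic to a corner `e M_k(A) e` with `e ≠ 0` (`MoritaEquivalence.exists_isCornerEmbedding`). It
remains to see that both properties pass to matrix algebras and to nonzero corners.

For locally matrix algebras, a matrix subalgebra `M_N(F)` containing `e` is cut down by `e` to
`M_r(F)`, where `r` is the rank of `e` (`IsCornerEmbedding.exists_matrixHom`).

For tensor products, the infinite tensor product is replaced by an internal description: `A` is a
tensor product of matrix algebras if and only if it is nonzero and generated by commuting images of
matrix algebras (`isTensorProductOfMatrixAlgebras_iff`). Such an algebra is locally matrix, hence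
simple, and this forces two such algebras with the same matrix sizes to be isomorphic
(`IsMatrixDecomposition.nonempty_algEquiv`). In these terms `M_k(A)` has one more factor than `A`;
and if `R = M_N(F) ⊗ C`, where `M_N(F)` is the product of finitely many factors and contains `e`,
then `e R e = e M_N(F) e ⊗ C` is again a tensor product of matrix algebras
(`IsCornerEmbedding.exists_isMatrixDecomposition`).
-/

/-! ### Homomorphisms from matrix algebras -/

section MatrixHom

variable {F : Type v} [Field F] {A : Type u} [Ring A] [Algebra F A]

lemma IsLocallyMatrixAlgebra.nontrivial (h : IsLocallyMatrixAlgebra F A) : Nontrivial A := by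
  obtain ⟨B, n, hn, -, ⟨e⟩⟩ := h ∅
  have : NeZero n := ⟨by lia⟩
  have : Nontrivial B := e.toEquiv.nontrivial
  exact (Subtype.val_injective (p := fun x => x ∈ B)).nontrivial

lemma Subalgebra.map_iSup {A : Type*} {B : Type*} [Ring A] [Ring B] [Algebra F A] [Algebra F B]
    {ι : Sort*} (g : A →ₐ[F] B) (S : ι → Subalgebra F A) : (⨆ i, S i).map g = ⨆ i, (S i).map g :=
  (Subalgebra.gc_map_comap g).l_iSup

/-- An algebra homomorphism from `M_n(F)`, `n ≥ 1`, to a nonzero algebra is injective, so its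
range is a copy of `M_n(F)`. -/
lemma matrixHom_injective [Nontrivial A] {n : ℕ} (hn : 1 ≤ n)
    (h : Matrix (Fin n) (Fin n) F →ₐ[F] A) : Function.Injective h := by
  have : NeZero n := ⟨by lia⟩
  have : IsSimpleRing (Matrix (Fin n) (Fin n) F) := inferInstance
  exact RingHom.injective h.toRingHom

/-- Locally matrix algebras described by homomorphisms from matrix algebras instead of
subalgebras. -/
lemma isLocallyMatrixAlgebra_iff : IsLocallyMatrixAlgebra F A ↔ Nontrivial A ∧
    ∀ s : Finset A, ∃ (n : ℕ) (h : Matrix (Fin n) (Fin n) F →ₐ[F] A), 1 ≤ n ∧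
      ∀ a ∈ s, a ∈ h.range := by
  refine ⟨fun h => ⟨h.nontrivial, fun s => ?_⟩, fun ⟨_, h⟩ s => ?_⟩
  · obtain ⟨B, n, hn, hs, ⟨e⟩⟩ := h s
    exact ⟨n, B.val.comp e.symm.toAlgHom, hn, fun a ha => ⟨e ⟨a, hs a ha⟩, by simp⟩⟩
  · obtain ⟨n, h, hn, hs⟩ := h s
    exact ⟨h.range, n, hn, hs, ⟨(AlgEquiv.ofInjective h (matrixHom_injective hn h)).symm⟩⟩

/-- Locally matrix algebras are simple; this is the form in which simplicity is used below. -/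
lemma IsLocallyMatrixAlgebra.injective (hA : IsLocallyMatrixAlgebra F A) {B : Type*} [Ring B]
    [Algebra F B] [Nontrivial B] (g : A →ₐ[F] B) : Function.Injective g := by
  rw [injective_iff_map_eq_zero]
  intro a ha
  obtain ⟨n, h, hn, hs⟩ := (isLocallyMatrixAlgebra_iff.1 hA).2 {a}
  obtain ⟨x, rfl⟩ := hs a (by simp)
  have : x = 0 := matrixHom_injective hn (g.comp h) (by simpa using ha)
  simp [this]

/-- Two commuting copies of `M_m(F)` and `M_n(F)` generate a quotient of
`M_m(F) ⊗ M_n(F) ≅ M_{mn}(F)`. -/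
lemma exists_matrixHom_range_eq_sup {m n : ℕ} (f : Matrix (Fin m) (Fin m) F →ₐ[F] A)
    (g : Matrix (Fin n) (Fin n) F →ₐ[F] A) (hfg : ∀ x y, Commute (f x) (g y)) :
    ∃ h : Matrix (Fin (m * n)) (Fin (m * n)) F →ₐ[F] A, h.range = f.range ⊔ g.range := by
  let e : Matrix (Fin m) (Fin m) F ⊗[F] Matrix (Fin n) (Fin n) F ≃ₐ[F]
      Matrix (Fin (m * n)) (Fin (m * n)) F :=
    (Matrix.kroneckerTMulAlgEquiv (Fin m) (Fin n) F F F F).trans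
      ((Algebra.TensorProduct.lid F F).mapMatrix.trans
        (Matrix.reindexAlgEquiv F F finProdFinEquiv))
  refine ⟨(Algebra.TensorProduct.lift f g hfg).comp e.symm.toAlgHom, le_antisymm ?_ ?_⟩
  · refine (AlgHom.range_comp_le_range _ _).trans ?_
    rintro _ ⟨x, rfl⟩
    induction x using TensorProduct.induction_on with
    | zero => simp
    | tmul x y => exact Algebra.mul_mem_sup (AlgHom.mem_range_self f x) (AlgHom.mem_range_self g y)
    | add x y hx hy => simpa using add_mem hx hy
  · rw [sup_le_iff]
    constructor
    · rintro _ ⟨x, rfl⟩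
      exact ⟨e (x ⊗ₜ 1), by simp⟩
    · rintro _ ⟨x, rfl⟩
      exact ⟨e (1 ⊗ₜ x), by simp⟩

end MatrixHom

/-! ### Commuting families of matrix subalgebras -/

section Decomposition

variable {F : Type v} [Field F] {A : Type u} [Ring A] [Algebra F A] {ι : Type w} {n : ι → ℕ}

/-- The family `f` of homomorphisms `M_{n_i}(F) → A` with commuting images that generate `A`
exhibits `A` as an internal tensor product of the matrix algebras `M_{n_i}(F)`. Injectivity of the
`f i` is automatic when `A` is nonzero. -/
structure IsMatrixDecomposition (f : ∀ i, Matrix (Fin (n i)) (Fin (n i)) F →ₐ[F] A) : Prop where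
  pos : ∀ i, 1 ≤ n i
  commute : Pairwise fun i j => ∀ x y, Commute (f i x) (f j y)
  iSup_range : ⨆ i, (f i).range = ⊤

variable {f : ∀ i, Matrix (Fin (n i)) (Fin (n i)) F →ₐ[F] A}

/-- If an element commutes with the images of the `f i`, `i ∈ s`, it commutes with the subalgebra
they generate. -/
lemma commute_of_mem_iSup_range {s : Set ι} {a b : A} (ha : ∀ i ∈ s, ∀ x, Commute (f i x) a)
    (hb : b ∈ ⨆ i ∈ s, (f i).range) : Commute b a := by
  have : ⨆ i ∈ s, (f i).range ≤ Subalgebra.centralizer F {a} := by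
    refine iSup₂_le fun i hi => ?_
    rintro _ ⟨x, rfl⟩
    rw [Subalgebra.mem_centralizer_iff]
    rintro _ rfl
    exact (ha i hi x).symm
  exact ((Subalgebra.mem_centralizer_iff F).1 (this hb) a rfl).symm

namespace IsMatrixDecomposition

/-- Finitely many of the commuting matrix algebras generate a matrix algebra. -/
lemma exists_matrixHom_range (hf : IsMatrixDecomposition f) (J : Finset ι) :
    ∃ (N : ℕ) (h : Matrix (Fin N) (Fin N) F →ₐ[F] A), 1 ≤ N ∧
      h.range = ⨆ i ∈ (J : Set ι), (f i).range := by
  classical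
  induction J using Finset.induction_on with
  | empty =>
    let e : Matrix (Fin 1) (Fin 1) F →ₐ[F] F :=
      AlgHom.ofLinearMap (Matrix.entryLinearMap F F 0 0) (by simp) (by simp [Matrix.mul_apply])
    refine ⟨1, (Algebra.ofId F A).comp e, le_rfl, ?_⟩
    simp only [Finset.coe_empty, Set.mem_empty_iff_false, iSup_false, iSup_bot, eq_bot_iff]
    refine (AlgHom.range_comp_le_range _ _).trans ?_
    rintro _ ⟨x, rfl⟩
    exact Subalgebra.algebraMap_mem _ x
  | insert a J ha ih =>
    obtain ⟨N, h, hN, hr⟩ := ih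
    obtain ⟨h', hr'⟩ := exists_matrixHom_range_eq_sup (f a) h fun x y => by
      refine (commute_of_mem_iSup_range (f := f) (s := J) (fun i hi z => ?_)
        (hr ▸ AlgHom.mem_range_self h y)).symm
      exact hf.commute (ne_of_mem_of_not_mem hi ha) z x
    refine ⟨_, h', Nat.mul_pos (hf.pos a) hN, ?_⟩
    rw [hr', hr, Finset.coe_insert, iSup_insert]

lemma exists_finset_mem (hf : IsMatrixDecomposition f) (a : A) :
    ∃ J : Finset ι, a ∈ ⨆ i ∈ (J : Set ι), (f i).range := by
  have ha : a ∈ ⨆ i, (f i).range := by simp [hf.iSup_range]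
  rw [iSup_eq_iSup_finset, ← SetLike.mem_coe, Subalgebra.coe_iSup_of_directed] at ha
  · simpa using ha
  · exact Monotone.directed_le fun s t hst => biSup_mono fun i hi => Finset.mem_of_subset hst hi

lemma isLocallyMatrixAlgebra [Nontrivial A] (hf : IsMatrixDecomposition f) :
    IsLocallyMatrixAlgebra F A := by
  classical
  refine isLocallyMatrixAlgebra_iff.2 ⟨inferInstance, fun s => ?_⟩
  choose J hJ using hf.exists_finset_mem
  obtain ⟨N, h, hN, hr⟩ := hf.exists_matrixHom_range (s.biUnion J)
  refine ⟨N, h, hN, fun a ha => ?_⟩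
  rw [hr]
  have hle : ⨆ i ∈ (J a : Set ι), (f i).range ≤ ⨆ i ∈ (s.biUnion J : Set ι), (f i).range :=
    biSup_mono fun i hi => Finset.mem_biUnion.2 ⟨a, ha, hi⟩
  exact hle (hJ a)

/-- A commuting family of matrix algebras decomposes the subalgebra it generates. -/
lemma of_iSup_range {S : Subalgebra F A} (hS : ⨆ i, (f i).range = S) (pos : ∀ i, 1 ≤ n i)
    (commute : Pairwise fun i j => ∀ x y, Commute (f i x) (f j y)) :
    ∃ f' : ∀ i, Matrix (Fin (n i)) (Fin (n i)) F →ₐ[F] S,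
      (∀ i, S.val.comp (f' i) = f i) ∧ IsMatrixDecomposition f' := by
  have hmem (i) (x) : f i x ∈ S := hS ▸ le_iSup (fun i => (f i).range) i (AlgHom.mem_range_self _ x)
  have hf' (i) : S.val.comp ((f i).codRestrict S (hmem i)) = f i := AlgHom.ext fun x => rfl
  refine ⟨fun i => (f i).codRestrict S (hmem i), hf', pos,
    fun i j hij x y => Subtype.ext (commute hij x y), ?_⟩
  refine Subalgebra.map_injective (f := S.val) Subtype.val_injective ?_
  simp only [Subalgebra.map_iSup, ← AlgHom.range_comp, hf', hS]
  simpa using S.range_val.symm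

/-- A nonzero algebra decomposed by a family of matrix algebras is determined by their sizes.
Given two such algebras `A` and `B`, the subalgebra of `A × B` generated by the diagonal copies of
the `M_{n_i}(F)` projects onto both, and the projections are injective because this subalgebra is
locally matrix, hence simple. -/
lemma nonempty_algEquiv {B : Type*} [Ring B] [Algebra F B] [Nontrivial A] [Nontrivial B]
    {g : ∀ i, Matrix (Fin (n i)) (Fin (n i)) F →ₐ[F] B}
    (hf : IsMatrixDecomposition f) (hg : IsMatrixDecomposition g) : Nonempty (A ≃ₐ[F] B) := by
  let G : Subalgebra F (A × B) := ⨆ i, ((f i).prod (g i)).range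
  obtain ⟨k, hk, hkG⟩ := of_iSup_range (f := fun i => (f i).prod (g i)) (S := G) rfl hf.pos
    fun i j hij x y => Prod.ext (hf.commute hij x y) (hg.commute hij x y)
  have hG : IsLocallyMatrixAlgebra F G := hkG.isLocallyMatrixAlgebra
  let p : G →ₐ[F] A := (AlgHom.fst F A B).comp G.val
  let q : G →ₐ[F] B := (AlgHom.snd F A B).comp G.val
  have hp : p.range = ⊤ := by
    rw [AlgHom.range_comp, Subalgebra.range_val, Subalgebra.map_iSup, ← hf.iSup_range]
    exact iSup_congr fun i => by rw [← AlgHom.range_comp]; rfl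
  have hq : q.range = ⊤ := by
    rw [AlgHom.range_comp, Subalgebra.range_val, Subalgebra.map_iSup, ← hg.iSup_range]
    exact iSup_congr fun i => by rw [← AlgHom.range_comp]; rfl
  exact ⟨(AlgEquiv.ofBijective p ⟨hG.injective p, AlgHom.range_eq_top p |>.1 hp⟩).symm.trans
    (AlgEquiv.ofBijective q ⟨hG.injective q, AlgHom.range_eq_top q |>.1 hq⟩)⟩

end IsMatrixDecomposition

end Decomposition

/-! ### Comparison with the infinite tensor product -/

section TensorProduct

variable {F : Type v} [Field F]

open Classical in
/-- The product of the `x i` if almost all of them are `1`, and `0` otherwise. -/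
noncomputable def finprodOrZero {ι : Type u} (x : ι → F) : F :=
  if (Function.mulSupport x).Finite then ∏ᶠ i, x i else 0

lemma finprodOrZero_update {ι : Type u} [DecidableEq ι] (x : ι → F) (i : ι) (a : F) :
    finprodOrZero (Function.update x i a) = a * finprodOrZero (Function.update x i 1) := by
  have hx : Function.update x i a = Pi.mulSingle i a * Function.update x i 1 := by
    ext j
    rcases eq_or_ne j i with rfl | hj <;> simp [*]
  have hfin : (Function.mulSupport (Pi.mulSingle i a : ι → F)).Finite :=
    (Set.finite_singleton i).subset Pi.mulSupport_mulSingle_subset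
  have hiff : (Function.mulSupport (Function.update x i a)).Finite ↔
      (Function.mulSupport (Function.update x i 1)).Finite := by
    refine ⟨fun h => h.subset fun j hj => ?_, fun h => ?_⟩
    · rcases eq_or_ne j i with rfl | hji <;> simp_all
    · rw [hx]
      exact (hfin.union h).subset (Function.mulSupport_mul _ _)
  unfold finprodOrZero
  by_cases h : (Function.mulSupport (Function.update x i 1)).Finite
  · rw [if_pos (hiff.2 h), if_pos h, hx]
    simp only [Pi.mul_apply]
    rw [finprod_mul_distrib hfin h, finprod_eq_single _ i fun j hj => by simp [hj]]
    simp
  · rw [if_neg (mt hiff.1 h), if_neg h, mul_zero]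

/-- `finprodOrZero` as a multilinear form on a possibly infinite family of copies of `F`. -/
noncomputable def finprodMultilinear (F : Type v) [Field F] (ι : Type u) :
    MultilinearMap F (fun _ : ι => F) F where
  toFun := finprodOrZero
  map_update_add' x i a b := by
    rw [finprodOrZero_update x i (a + b), finprodOrZero_update x i a,
      finprodOrZero_update x i b, add_mul]
  map_update_smul' x i c a := by
    rw [finprodOrZero_update x i (c • a), finprodOrZero_update x i a, smul_mul_assoc]

variable {ι : Type u} (n : ι → ℕ)

/-- The infinite tensor product of matrix algebras is nonzero: `⨂ 1` is not killed by the
multilinear form `finprodMultilinear` applied to the top left entries. -/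
lemma nontrivial_piTensorProduct_matrix (hn : ∀ i, 1 ≤ n i) :
    Nontrivial (⨂[F] i, Matrix (Fin (n i)) (Fin (n i)) F) := by
  have hn' (i) : NeZero (n i) := ⟨by have := hn i; lia⟩
  let φ : MultilinearMap F (fun i => Matrix (Fin (n i)) (Fin (n i)) F) F :=
    (finprodMultilinear F ι).compLinearMap fun i => Matrix.entryLinearMap F F 0 0
  refine ⟨⟨1, 0, fun h => one_ne_zero (α := F) ?_⟩⟩
  have := congrArg (PiTensorProduct.lift φ) h
  rw [map_zero, PiTensorProduct.one_def, PiTensorProduct.lift.tprod] at this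
  rw [← this]
  simp [φ, finprodMultilinear, finprodOrZero, Function.mulSupport]

lemma exists_isMatrixDecomposition_algebraTensorProduct (hn : ∀ i, 1 ≤ n i) :
    ∃ f : ∀ i, Matrix (Fin (n i)) (Fin (n i)) F →ₐ[F]
      algebraTensorProduct F (fun i => Matrix (Fin (n i)) (Fin (n i)) F),
      IsMatrixDecomposition f := by
  classical
  obtain ⟨f, -, hf⟩ := IsMatrixDecomposition.of_iSup_range (F := F)
    (f := fun i => PiTensorProduct.singleAlgHom (R := F)
      (A := fun i => Matrix (Fin (n i)) (Fin (n i)) F) i)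
    (S := algebraTensorProduct F (fun i => Matrix (Fin (n i)) (Fin (n i)) F))
    (by unfold algebraTensorProduct; congr!) hn
    fun i j hij x y => Commute.tprod
      (Pi.mulSingle_commute (f := fun i => Matrix (Fin (n i)) (Fin (n i)) F) hij x y)
  exact ⟨f, hf⟩

lemma isTensorProductOfMatrixAlgebras_iff {A : Type u} [Ring A] [Algebra F A] :
    IsTensorProductOfMatrixAlgebras F A ↔ Nontrivial A ∧ ∃ (ι : Type u) (n : ι → ℕ)
      (f : ∀ i, Matrix (Fin (n i)) (Fin (n i)) F →ₐ[F] A), IsMatrixDecomposition f := by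
  constructor
  · rintro ⟨ι, n, hn, ⟨e⟩⟩
    have := nontrivial_piTensorProduct_matrix (F := F) n hn
    refine ⟨e.toEquiv.nontrivial, ι, n, ?_⟩
    obtain ⟨f, hf⟩ := exists_isMatrixDecomposition_algebraTensorProduct (F := F) n hn
    refine ⟨fun i => e.symm.toAlgHom.comp (f i), hn, fun i j hij x y =>
      (hf.commute hij x y).map e.symm.toAlgHom, ?_⟩
    simp only [AlgHom.range_comp, ← Subalgebra.map_iSup, hf.iSup_range, Algebra.map_top]
    exact (AlgHom.range_eq_top e.symm.toAlgHom).2 e.symm.surjective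
  · rintro ⟨_, ι, n, f, hf⟩
    have := nontrivial_piTensorProduct_matrix (F := F) n hf.pos
    obtain ⟨g, hg⟩ := exists_isMatrixDecomposition_algebraTensorProduct (F := F) n hf.pos
    exact ⟨ι, n, hf.pos, hf.nonempty_algEquiv hg⟩

end TensorProduct

/-! ### Morita equivalence and corners of matrix algebras -/

/-- The non-unital homomorphism `φ : B → R` identifies `B` with the corner `e R e`, where
`e = φ 1`. -/
structure IsCornerEmbedding {F : Type*} [Field F] {B R : Type*} [Ring B] [Algebra F B] [Ring R]
    [Algebra F R] (φ : B →ₙₐ[F] R) : Prop where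
  injective : Function.Injective φ
  mem_range : ∀ x, φ 1 * x * φ 1 = x → ∃ b, φ b = x

section Morita

open CategoryTheory
open scoped ModuleCat.Algebra

variable {F : Type v} [Field F] {A B : Type u} [Ring A] [Algebra F A] [Ring B] [Algebra F B]

namespace MoritaEquivalence

variable (e : MoritaEquivalence F B A)

/-- The `B`-module corresponding to the regular `A`-module. -/
noncomputable abbrev progenerator : ModuleCat.{u} B := e.eqv.inverse.obj (ModuleCat.of A A)

/-- The identification of `A` with the image of the progenerator. -/
noncomputable abbrev progeneratorIso : e.eqv.functor.obj e.progenerator ≅ ModuleCat.of A A :=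
  e.eqv.counitIso.app _

/-- The trace ideal of the progenerator is all of `B`. A homomorphism out of `B` that kills the
trace ideal corresponds to a homomorphism of `A`-modules killed by every map from `A`, hence to
zero. -/
lemma span_trace_eq_top :
    Submodule.span B {b : B | ∃ (ψ : e.progenerator →ₗ[B] B) (q : e.progenerator), ψ q = b} =
      ⊤ := by
  set I := Submodule.span B
    {b : B | ∃ (ψ : e.progenerator →ₗ[B] B) (q : e.progenerator), ψ q = b} with hI
  let m : ModuleCat.of B B ⟶ ModuleCat.of B (B ⧸ I) := ModuleCat.ofHom I.mkQ
  have hm : e.eqv.functor.map m = 0 := by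
    ext p
    let t : ModuleCat.of A A ⟶ e.eqv.functor.obj (ModuleCat.of B B) :=
      ModuleCat.ofHom (LinearMap.toSpanSingleton A _ p)
    let ψ : e.progenerator ⟶ ModuleCat.of B B :=
      e.eqv.functor.preimage (e.progeneratorIso.hom ≫ t)
    have hψ : ψ ≫ m = 0 := by
      ext q
      exact (Submodule.Quotient.mk_eq_zero I).2 (Submodule.subset_span ⟨ψ.hom, q, rfl⟩)
    have h0 : t ≫ e.eqv.functor.map m = 0 := by
      rw [← cancel_epi e.progeneratorIso.hom, ← Category.assoc, ← e.eqv.functor.map_preimage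
        (e.progeneratorIso.hom ≫ t), ← Functor.map_comp, hψ, Functor.map_zero, Limits.comp_zero]
    have := congrArg (fun g => g.hom (1 : A)) h0
    simpa [t] using this
  have hm0 : m = 0 := e.eqv.functor.map_injective (by rw [hm, Functor.map_zero])
  have : I.mkQ = 0 := congrArg ModuleCat.Hom.hom hm0
  rw [← Submodule.ker_mkQ I, this, LinearMap.ker_zero]

/-- The `A`-module corresponding to the regular `B`-module is a direct summand of a finite free
module. -/
lemma exists_retract : ∃ (k : ℕ)
    (i : e.eqv.functor.obj (ModuleCat.of B B) →ₗ[A] (Fin k → A))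
    (p : (Fin k → A) →ₗ[A] e.eqv.functor.obj (ModuleCat.of B B)), p ∘ₗ i = LinearMap.id := by
  have h1 : (1 : B) ∈ Submodule.span B
      {b : B | ∃ (ψ : e.progenerator →ₗ[B] B) (q : e.progenerator), ψ q = b} := by
    rw [e.span_trace_eq_top]; trivial
  obtain ⟨k, c, g, hg⟩ := Submodule.mem_span_set'.1 h1
  choose ψ q hψ using fun j => (g j).2
  let χ (j : Fin k) : ModuleCat.of B B ⟶ e.progenerator :=
    ModuleCat.ofHom (LinearMap.toSpanSingleton B _ (c j • q j))
  let ψ' (j : Fin k) : e.progenerator ⟶ ModuleCat.of B B := ModuleCat.ofHom (ψ j)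
  have hsum : ∑ j, χ j ≫ ψ' j = 𝟙 (ModuleCat.of B B) := by
    ext
    simp only [χ, ψ', ModuleCat.hom_sum, LinearMap.sum_apply, ModuleCat.hom_comp]
    simpa [hψ] using hg
  refine ⟨k, LinearMap.pi fun j => (e.eqv.functor.map (χ j) ≫ e.progeneratorIso.hom).hom,
    ∑ j, (e.progeneratorIso.inv ≫ e.eqv.functor.map (ψ' j)).hom ∘ₗ LinearMap.proj j, ?_⟩
  have := congrArg (fun g => (e.eqv.functor.map g).hom) hsum
  simp only [Functor.map_sum, Functor.map_comp, CategoryTheory.Functor.map_id] at this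
  refine LinearMap.ext fun x => ?_
  have hx := LinearMap.congr_fun this x
  simp only [ModuleCat.hom_sum, LinearMap.sum_apply, ModuleCat.hom_comp, ModuleCat.hom_id,
    LinearMap.comp_apply, LinearMap.id_apply] at hx ⊢
  conv_rhs => rw [← hx]
  refine Finset.sum_congr rfl fun j _ => ?_
  simp only [LinearMap.proj_apply, LinearMap.pi_apply, LinearMap.comp_apply]
  congr 1
  exact LinearMap.congr_fun (congrArg ModuleCat.Hom.hom e.progeneratorIso.hom_inv_id) _

/-- The endomorphism of the `A`-module `e(B)` corresponding to right multiplication by `b`. -/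
noncomputable def rightMul (b : B) : Module.End A (e.eqv.functor.obj (ModuleCat.of B B)) :=
  (e.eqv.functor.map (X := ModuleCat.of B B) (Y := ModuleCat.of B B)
    (ModuleCat.ofHom (LinearMap.toSpanSingleton B B b))).hom

lemma rightMul_one : e.rightMul 1 = LinearMap.id := by
  have : ModuleCat.ofHom (LinearMap.toSpanSingleton B B 1) = 𝟙 (ModuleCat.of B B) := by
    ext; simp
  rw [rightMul, this, CategoryTheory.Functor.map_id, ModuleCat.hom_id]

lemma rightMul_mul (b c : B) : e.rightMul (b * c) = e.rightMul c ∘ₗ e.rightMul b := by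
  rw [rightMul, rightMul, rightMul, ← ModuleCat.hom_comp, ← Functor.map_comp]
  congr 2
  ext
  simp

lemma rightMul_add (b c : B) : e.rightMul (b + c) = e.rightMul b + e.rightMul c := by
  rw [rightMul, rightMul, rightMul, ← ModuleCat.hom_add, ← Functor.map_add]
  congr 2
  ext
  simp

lemma rightMul_smul (r : F) (b : B) (x : e.eqv.functor.obj (ModuleCat.of B B)) :
    e.rightMul (r • b) x = algebraMap F A r • e.rightMul b x := by
  refine Eq.trans ?_ (congrArg (fun g => g.hom x) (CategoryTheory.Functor.map_smul e.eqv.functor r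
    (ModuleCat.ofHom (LinearMap.toSpanSingleton B B b))))
  refine congrArg (fun g => (e.eqv.functor.map g).hom x) ?_
  ext
  -- On morphisms of modules, `F` acts through `algebraMap F B`.
  change (1 : B) • (r • b) = algebraMap F B r • ((1 : B) • b)
  simp [Algebra.smul_def]

lemma rightMul_bijective : Function.Bijective e.rightMul := by
  constructor
  · intro b c h
    have h' := e.eqv.functor.map_injective (ModuleCat.hom_injective h)
    simpa using congrArg (fun g => g.hom (1 : B)) h'
  · intro f
    let g : ModuleCat.of B B ⟶ ModuleCat.of B B := e.eqv.functor.preimage (ModuleCat.ofHom f)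
    have hg : ModuleCat.ofHom (LinearMap.toSpanSingleton B B (g.hom (1 : B))) = g := by
      ext; simp
    refine ⟨g.hom (1 : B), ?_⟩
    rw [rightMul, hg, Functor.map_preimage, ModuleCat.hom_ofHom]

/-- One half of Morita's theorem: an algebra Morita equivalent to `A` is a corner of a matrix
algebra over `A`. -/
lemma exists_isCornerEmbedding (e : MoritaEquivalence F B A) :
    ∃ (k : ℕ) (φ : B →ₙₐ[F] Matrix (Fin k) (Fin k) A), IsCornerEmbedding φ := by
  obtain ⟨k, i, p, hpi⟩ := e.exists_retract
  have hpi' (x) : p (i x) = x := LinearMap.congr_fun hpi x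
  -- Matrices act on row vectors from the right, which turns the anti-homomorphism `rightMul`
  -- into a homomorphism.
  let φ : B →ₙₐ[F] Matrix (Fin k) (Fin k) A :=
    { toFun := fun b => LinearMap.toMatrixRight' (i ∘ₗ e.rightMul b ∘ₗ p)
      map_zero' := by
        have : e.rightMul 0 = 0 := by simpa using e.rightMul_add 0 0
        simp [this]
      map_add' := fun b c => by
        rw [rightMul_add, LinearMap.add_comp, LinearMap.comp_add, map_add]
      map_mul' := fun b c => by
        rw [← LinearMap.toMatrixRight'_comp, rightMul_mul]
        congr 1
        refine LinearMap.ext fun x => ?_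
        simp [LinearMap.comp_apply, hpi']
      map_smul' := fun r b => by
        ext j l
        change i (e.rightMul (r • b) (p _)) l = r • i (e.rightMul b (p _)) l
        rw [rightMul_smul, map_smul, Pi.smul_apply, algebraMap_smul] }
  have hφ (b) : φ b = LinearMap.toMatrixRight' (i ∘ₗ e.rightMul b ∘ₗ p) := rfl
  refine ⟨k, φ, fun b c h => ?_, fun x hx => ?_⟩
  · have h' := LinearMap.toMatrixRight'.injective h
    refine e.rightMul_bijective.1 (LinearMap.ext fun y => ?_)
    have := congrArg p (LinearMap.congr_fun h' (i y))
    simpa [hpi'] using this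
  · obtain ⟨f, rfl⟩ := LinearMap.toMatrixRight'.surjective x
    obtain ⟨b, hb⟩ := e.rightMul_bijective.2 (p ∘ₗ f ∘ₗ i)
    refine ⟨b, ?_⟩
    rw [hφ, rightMul_one, ← LinearMap.toMatrixRight'_comp, ← LinearMap.toMatrixRight'_comp] at hx
    rw [← hx, hφ, hb]
    rfl

end MoritaEquivalence

end Morita

/-! ### Passing to matrix algebras -/

section Matrix

variable {F : Type v} [Field F] {A : Type u} [Ring A] [Algebra F A]

lemma IsLocallyMatrixAlgebra.matrix (hA : IsLocallyMatrixAlgebra F A) {k : ℕ} (hk : 1 ≤ k) :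
    IsLocallyMatrixAlgebra F (Matrix (Fin k) (Fin k) A) := by
  classical
  have := hA.nontrivial
  have : NeZero k := ⟨by lia⟩
  refine isLocallyMatrixAlgebra_iff.2 ⟨inferInstance, fun s => ?_⟩
  obtain ⟨n, h, hn, hs⟩ := (isLocallyMatrixAlgebra_iff.1 hA).2
    (s.biUnion fun M => Finset.univ.image fun p : Fin k × Fin k => M p.1 p.2)
  let e : Matrix (Fin k) (Fin k) (Matrix (Fin n) (Fin n) F) ≃ₐ[F]
      Matrix (Fin (k * n)) (Fin (k * n)) F :=
    (Matrix.compAlgEquiv (Fin k) (Fin n) F F).trans (Matrix.reindexAlgEquiv F F finProdFinEquiv)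
  refine ⟨k * n, h.mapMatrix.comp e.symm.toAlgHom, Nat.mul_pos hk hn, fun M hM => ?_⟩
  have hM' (i j) : M i j ∈ h.range :=
    hs _ (Finset.mem_biUnion.2 ⟨M, hM, Finset.mem_image.2 ⟨(i, j), Finset.mem_univ _, rfl⟩⟩)
  choose x hx using hM'
  refine ⟨e (Matrix.of x), ?_⟩
  ext i j
  simpa using hx i j

/-- Adjoining a commuting matrix algebra to an algebra decomposed by matrix algebras. -/
lemma IsMatrixDecomposition.option {C : Type*} [Ring C] [Algebra F C] {ι : Type w} {n : ι → ℕ}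
    {f : ∀ i, Matrix (Fin (n i)) (Fin (n i)) F →ₐ[F] C} (hf : IsMatrixDecomposition f)
    (κ : C →ₐ[F] A) {r : ℕ} (hr : 1 ≤ r) (g : Matrix (Fin r) (Fin r) F →ₐ[F] A)
    (hg : ∀ x c, Commute (g x) (κ c)) (hsup : g.range ⊔ κ.range = ⊤) :
    ∃ (n' : Option ι → ℕ) (f' : ∀ i, Matrix (Fin (n' i)) (Fin (n' i)) F →ₐ[F] A),
      IsMatrixDecomposition f' := by
  refine ⟨fun o => o.elim r n, fun o => match o with
    | none => g
    | some i => κ.comp (f i), ?_, ?_, ?_⟩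
  · rintro (_ | i)
    exacts [hr, hf.pos i]
  · rintro (_ | i) (_ | j) hij x y
    · exact absurd rfl hij
    · exact hg _ _
    · exact (hg _ _).symm
    · exact (hf.commute (fun h => hij (congrArg some h)) x y).map κ
  · rw [iSup_option, ← hsup]
    congr 1
    rw [← Algebra.map_top, ← hf.iSup_range, Subalgebra.map_iSup]
    exact iSup_congr fun i => AlgHom.range_comp _ _

lemma IsTensorProductOfMatrixAlgebras.matrix (hA : IsTensorProductOfMatrixAlgebras F A) {k : ℕ}
    (hk : 1 ≤ k) : IsTensorProductOfMatrixAlgebras F (Matrix (Fin k) (Fin k) A) := by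
  obtain ⟨_, ι, n, f, hf⟩ := isTensorProductOfMatrixAlgebras_iff.1 hA
  have : NeZero k := ⟨by lia⟩
  refine isTensorProductOfMatrixAlgebras_iff.2 ⟨inferInstance, Option ι, ?_⟩
  refine hf.option (Matrix.scalarAlgHom (Fin k) F) hk (Algebra.ofId F A).mapMatrix
    (fun x c => ?_) ?_
  · ext i j
    simp [Matrix.scalarAlgHom, Algebra.ofId_apply, Algebra.commutes]
  · rw [eq_top_iff]
    intro M _
    rw [Matrix.matrix_eq_sum_single M]
    refine sum_mem fun i _ => sum_mem fun j _ => ?_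
    have : Matrix.single i j (M i j) = (Algebra.ofId F A).mapMatrix (Matrix.single i j 1) *
        Matrix.scalarAlgHom (Fin k) F (M i j) := by
      ext i' j'
      simp [Matrix.scalarAlgHom, Matrix.single_apply, Algebra.ofId_apply, apply_ite]
      grind
    rw [this]
    exact Algebra.mul_mem_sup (AlgHom.mem_range_self _ _) (AlgHom.mem_range_self _ _)

end Matrix

/-! ### Passing to corners -/

section Corner

variable {F : Type v} [Field F] {B R : Type*} [Ring B] [Algebra F B] [Ring R] [Algebra F R]

/-- An idempotent matrix of rank `r` factors through `F^r` with the factors being one-sided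
inverses of each other. -/
lemma Matrix.exists_factorization_of_isIdempotentElem {N : ℕ} {e : Matrix (Fin N) (Fin N) F}
    (he : IsIdempotentElem e) : ∃ (r : ℕ) (i : Matrix (Fin N) (Fin r) F)
      (p : Matrix (Fin r) (Fin N) F), i * p = e ∧ p * i = 1 := by
  let T := Matrix.toLin' e
  have hT (x) : T (T x) = T x := by
    rw [← LinearMap.comp_apply, ← Matrix.toLin'_mul, he.eq]
  let b := (Module.finBasis F (LinearMap.range T)).equivFun
  refine ⟨_, LinearMap.toMatrix' ((LinearMap.range T).subtype ∘ₗ b.symm.toLinearMap),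
    LinearMap.toMatrix' (b.toLinearMap ∘ₗ T.rangeRestrict), ?_, ?_⟩
  · rw [← LinearMap.toMatrix'_comp, ← LinearMap.toMatrix'_toLin' e]
    congr 1
    refine LinearMap.ext fun x => ?_
    simp [T]
  · rw [← LinearMap.toMatrix'_comp, ← LinearMap.toMatrix'_id]
    congr 1
    refine LinearMap.ext fun x => ?_
    have : T.rangeRestrict (b.symm x : Fin N → F) = b.symm x := by
      obtain ⟨y, hy⟩ := (b.symm x).2
      refine Subtype.ext ?_
      change T _ = _
      rw [← hy, hT]
    simp [this]

namespace IsCornerEmbedding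

variable {φ : B →ₙₐ[F] R}

lemma map_one_mul (b : B) : φ 1 * φ b = φ b := by rw [← map_mul, one_mul]

lemma map_mul_one (b : B) : φ b * φ 1 = φ b := by rw [← map_mul, mul_one]

/-- Non-unital homomorphisms into `R` that send `1` to the idempotent of the corner are the
same as unital homomorphisms into the corner. -/
lemma exists_lift (hφ : IsCornerEmbedding φ) {C : Type*} [Ring C] [Algebra F C]
    (ψ : C →ₙₐ[F] R) (h1 : ψ 1 = φ 1) : ∃ g : C →ₐ[F] B, ∀ x, φ (g x) = ψ x := by
  choose g hg using fun x => hφ.mem_range (ψ x) (by rw [← h1, ← map_mul, ← map_mul]; simp)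
  refine ⟨AlgHom.ofLinearMap ⟨⟨g, fun x y => hφ.injective ?_⟩, fun c x => hφ.injective ?_⟩
    (hφ.injective ?_) fun x y => hφ.injective ?_, hg⟩
  · simp [hg]
  · simp [hg]
  · simp [hg, h1]
  · simp [hg]

/-- If the idempotent of a corner lies in a matrix subalgebra `M_N(F)` of `R`, then the corner cuts
`M_N(F)` down to the matrix algebra `M_r(F)`, where `r` is the rank of the idempotent. -/
lemma exists_matrixHom [Nontrivial B] (hφ : IsCornerEmbedding φ) {N : ℕ} (hN : 1 ≤ N)
    (h : Matrix (Fin N) (Fin N) F →ₐ[F] R) (h1 : φ 1 ∈ h.range) :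
    ∃ (r : ℕ) (g : Matrix (Fin r) (Fin r) F →ₐ[F] B), 1 ≤ r ∧ (∀ x, φ (g x) ∈ h.range) ∧
      ∀ b, φ b ∈ h.range → b ∈ g.range := by
  have : Nontrivial R := hφ.injective.nontrivial
  obtain ⟨e, he⟩ := h1
  have heh : h e = φ 1 := he
  have hidem : IsIdempotentElem e := matrixHom_injective hN h (by
    rw [map_mul, heh, map_mul_one])
  obtain ⟨r, i, p, hip, hpi⟩ := Matrix.exists_factorization_of_isIdempotentElem hidem
  let θ : Matrix (Fin r) (Fin r) F →ₙₐ[F] Matrix (Fin N) (Fin N) F :=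
    { toFun := fun x => i * x * p
      map_zero' := by simp
      map_add' := fun x y => by rw [Matrix.mul_add, Matrix.add_mul]
      map_mul' := fun x y => by
        have : i * x * p * (i * y * p) = i * x * (p * i) * y * p := by simp only [Matrix.mul_assoc]
        rw [this, hpi]
        simp only [Matrix.mul_assoc, Matrix.one_mul]
      map_smul' := fun c x => by simp }
  have hθ (x) : θ x = i * x * p := rfl
  obtain ⟨g, hg⟩ := hφ.exists_lift ((h : Matrix (Fin N) (Fin N) F →ₙₐ[F] R).comp θ) (by
    change h (θ 1) = φ 1
    rw [← heh, hθ, Matrix.mul_one, hip])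
  have hg' (x) : φ (g x) = h (θ x) := hg x
  refine ⟨r, g, ?_, fun x => ⟨θ x, (hg' x).symm⟩, ?_⟩
  · by_contra hr
    obtain rfl : r = 0 := by lia
    refine one_ne_zero (α := B) ?_
    rw [← map_one g, Subsingleton.elim (1 : Matrix (Fin 0) (Fin 0) F) 0, map_zero]
  · rintro b ⟨y, hy⟩
    have hyh : h y = φ b := hy
    refine ⟨p * y * i, hφ.injective ?_⟩
    have : θ (p * y * i) = e * y * e := by
      rw [hθ, ← hip]
      simp only [Matrix.mul_assoc]
    change φ (g _) = _
    rw [hg', this, map_mul, map_mul, heh, hyh, map_one_mul, map_mul_one]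

lemma isLocallyMatrixAlgebra [Nontrivial B] (hφ : IsCornerEmbedding φ)
    (hR : IsLocallyMatrixAlgebra F R) : IsLocallyMatrixAlgebra F B := by
  classical
  refine isLocallyMatrixAlgebra_iff.2 ⟨inferInstance, fun s => ?_⟩
  obtain ⟨N, h, hN, hs⟩ := (isLocallyMatrixAlgebra_iff.1 hR).2 (insert (φ 1) (s.image φ))
  obtain ⟨r, g, hr, -, hg⟩ := hφ.exists_matrixHom hN h (hs _ (Finset.mem_insert_self _ _))
  exact ⟨r, g, hr, fun a ha =>
    hg a (hs _ (Finset.mem_insert_of_mem (Finset.mem_image_of_mem _ ha)))⟩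

/-- If `R` is the internal tensor product of the matrix algebras `M_{n_i}(F)`, then the idempotent
`e` of the corner lies in the tensor product `M_N(F)` of finitely many of them, and the corner
is `e M_N(F) e ⊗ C`, where `C` is the tensor product of the remaining factors. -/
lemma exists_isMatrixDecomposition [Nontrivial B] (hφ : IsCornerEmbedding φ) {ι : Type w}
    {n : ι → ℕ} {f : ∀ i, Matrix (Fin (n i)) (Fin (n i)) F →ₐ[F] R}
    (hf : IsMatrixDecomposition f) :
    ∃ (ι' : Type w) (n' : ι' → ℕ) (f' : ∀ i, Matrix (Fin (n' i)) (Fin (n' i)) F →ₐ[F] B),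
      IsMatrixDecomposition f' := by
  classical
  obtain ⟨J, hJ⟩ := hf.exists_finset_mem (φ 1)
  obtain ⟨N, h, hN, hh⟩ := hf.exists_matrixHom_range J
  rw [← hh] at hJ
  obtain ⟨r, g, hr, hgh, hg⟩ := hφ.exists_matrixHom hN h hJ
  let C : Subalgebra F R := ⨆ i : {i // i ∉ J}, (f i).range
  obtain ⟨k, -, hk⟩ := IsMatrixDecomposition.of_iSup_range
    (f := fun i : {i // i ∉ J} => f i) (S := C) rfl (fun i => hf.pos i)
    fun i j hij => hf.commute fun h => hij (Subtype.ext h)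
  have hcomm {y c : R} (hy : y ∈ h.range) (hc : c ∈ C) : Commute y c := by
    rw [hh] at hy
    refine commute_of_mem_iSup_range (fun i hi x => ?_) hy
    have hc' : c ∈ ⨆ i ∈ {i | i ∉ J}, (f i).range := by
      change c ∈ ⨆ i, ⨆ (_ : i ∉ J), (f i).range
      simpa only [C, iSup_subtype] using hc
    refine (commute_of_mem_iSup_range (fun j hj z => ?_) hc').symm
    exact hf.commute (ne_of_mem_of_not_mem hi hj).symm z x
  let ψ : C →ₙₐ[F] R :=
    { toFun := fun c => φ 1 * c
      map_zero' := by simp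
      map_add' := fun x y => by simp [mul_add]
      map_mul' := fun x y => by
        rw [mul_assoc, ← mul_assoc (x : R), ← (hcomm hJ x.2).eq, ← mul_assoc, ← mul_assoc,
          map_mul_one, mul_assoc]
        rfl
      map_smul' := fun c x => by simp }
  obtain ⟨κ, hκ⟩ := hφ.exists_lift ψ (by simp [ψ])
  have hκ' (c) : φ (κ c) = φ 1 * c := hκ c
  have key (y : R) : ∃ b ∈ g.range ⊔ κ.range, φ b = φ 1 * y * φ 1 := by
    let L := Algebra.TensorProduct.lift h.range.val C.val fun y c => hcomm y.2 c.2
    have hL : L.range = ⊤ := by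
      rw [eq_top_iff, ← hf.iSup_range, iSup_le_iff]
      intro i
      by_cases hi : i ∈ J
      · refine le_trans (b := h.range) ?_ ?_
        · rw [hh]
          exact le_biSup (fun i => (f i).range) (Finset.mem_coe.2 hi)
        · exact fun y hy => ⟨⟨y, hy⟩ ⊗ₜ 1, by simp [L]⟩
      · refine le_trans (b := C) ?_ ?_
        · exact le_iSup (fun i : {i // i ∉ J} => (f i).range) ⟨i, hi⟩
        · exact fun c hc => ⟨1 ⊗ₜ ⟨c, hc⟩, by simp [L]⟩
    obtain ⟨t, rfl⟩ := (AlgHom.range_eq_top L).1 hL y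
    induction t using TensorProduct.induction_on with
    | zero => exact ⟨0, zero_mem _, by simp⟩
    | add x y hx hy =>
      obtain ⟨b, hb, hbx⟩ := hx
      obtain ⟨c, hc, hcy⟩ := hy
      exact ⟨b + c, add_mem hb hc, by rw [map_add, map_add, hbx, hcy, mul_add, add_mul]⟩
    | tmul y c =>
      obtain ⟨b, hb⟩ := hφ.mem_range (φ 1 * y * φ 1) (by
        rw [mul_assoc, mul_assoc, map_mul_one, ← mul_assoc, ← mul_assoc, map_mul_one])
      refine ⟨b * κ c, Algebra.mul_mem_sup (hg b ?_) (AlgHom.mem_range_self _ _), ?_⟩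
      · rw [hb]
        exact mul_mem (mul_mem hJ y.2) hJ
      · rw [map_mul, hb, hκ', mul_assoc (φ 1 * (y : R)), ← mul_assoc (φ 1) (φ 1), map_mul_one,
          (hcomm hJ c.2).eq]
        simp [L, mul_assoc]
  refine ⟨Option {i // i ∉ J}, hk.option κ hr g (fun x c => hφ.injective ?_) ?_⟩
  · rw [map_mul, map_mul, hκ', ← mul_assoc, map_mul_one, mul_assoc, ← (hcomm (hgh x) c.2).eq,
      ← mul_assoc, map_one_mul]
  · rw [eq_top_iff]
    intro b _
    obtain ⟨b', hb', hbb'⟩ := key (φ b)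
    rw [map_one_mul, map_mul_one] at hbb'
    exact hφ.injective hbb' ▸ hb'

end IsCornerEmbedding

end Corner

/-! ### Morita invariance -/

section Invariance

variable {F : Type v} [Field F]

lemma IsTensorProductOfMatrixAlgebras.of_isCornerEmbedding {B R : Type u} [Ring B] [Algebra F B]
    [Ring R] [Algebra F R] [Nontrivial B] {φ : B →ₙₐ[F] R} (hφ : IsCornerEmbedding φ)
    (hR : IsTensorProductOfMatrixAlgebras F R) : IsTensorProductOfMatrixAlgebras F B := by
  obtain ⟨-, ι, n, f, hf⟩ := isTensorProductOfMatrixAlgebras_iff.1 hR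
  exact isTensorProductOfMatrixAlgebras_iff.2 ⟨inferInstance, hφ.exists_isMatrixDecomposition hf⟩

variable {A B : Type u} [Ring A] [Algebra F A] [Ring B] [Algebra F B]

lemma IsMoritaEquivalent.nontrivial (h : IsMoritaEquivalent F A B) [Nontrivial A] :
    Nontrivial B := by
  obtain ⟨k, φ, hφ⟩ := h.cond.some.exists_isCornerEmbedding
  by_contra hB
  rw [not_nontrivial_iff_subsingleton] at hB
  exact not_subsingleton A hφ.injective.subsingleton

/-- An algebra Morita equivalent to a nonzero algebra `B` is a corner of a matrix algebra of
positive size over `B`. -/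
lemma IsMoritaEquivalent.exists_isCornerEmbedding (h : IsMoritaEquivalent F A B) [Nontrivial B] :
    ∃ (k : ℕ) (φ : A →ₙₐ[F] Matrix (Fin k) (Fin k) B),
      Nontrivial A ∧ 1 ≤ k ∧ IsCornerEmbedding φ := by
  have := (h.symm F).nontrivial
  obtain ⟨k, φ, hφ⟩ := h.cond.some.exists_isCornerEmbedding
  refine ⟨k, φ, this, Nat.one_le_iff_ne_zero.2 ?_, hφ⟩
  rintro rfl
  exact not_subsingleton A hφ.injective.subsingleton

lemma IsMoritaEquivalent.isLocallyMatrixAlgebra (h : IsMoritaEquivalent F A B)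
    (hB : IsLocallyMatrixAlgebra F B) : IsLocallyMatrixAlgebra F A := by
  have := hB.nontrivial
  obtain ⟨k, φ, _, hk, hφ⟩ := h.exists_isCornerEmbedding
  exact hφ.isLocallyMatrixAlgebra (hB.matrix hk)

lemma IsMoritaEquivalent.isTensorProductOfMatrixAlgebras (h : IsMoritaEquivalent F A B)
    (hB : IsTensorProductOfMatrixAlgebras F B) : IsTensorProductOfMatrixAlgebras F A := by
  have := (isTensorProductOfMatrixAlgebras_iff.1 hB).1
  obtain ⟨k, φ, _, hk, hφ⟩ := h.exists_isCornerEmbedding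
  exact .of_isCornerEmbedding hφ (hB.matrix hk)

end Invariance

theorem lemma3p2 (F : Type v) [Field F] :
    IsMoritaInvariant.{u, v} F (fun A [Ring A] [Algebra F A] => IsLocallyMatrixAlgebra F A) ∧
    IsMoritaInvariant.{u, v} F
      (fun A [Ring A] [Algebra F A] => IsTensorProductOfMatrixAlgebras F A) := by
  refine ⟨fun A B _ _ _ _ h => ⟨fun hA => ?_, fun hB => ?_⟩,
    fun A B _ _ _ _ h => ⟨fun hA => ?_, fun hB => ?_⟩⟩
  · exact (h.symm F).isLocallyMatrixAlgebra hA
  · exact h.isLocallyMatrixAlgebra hB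
  · exact (h.symm F).isTensorProductOfMatrixAlgebras hA
  · exact h.isTensorProductOfMatrixAlgebras hB
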